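/- For $n\ge 0$ and $1\le i<n$ let $\xi_i$ be the operator on $\mathbb{Q}[x_1,\dots,x_n]$ given by $\xi_i(f)=\frac{x_i f-x_{i+1}\,s_i(f)}{x_i-x_{i+1}}$, where $s_i$ interchanges $x_i$ and $x_{i+1}$. The key polynomials $\mathcal{K}_\alpha\in\mathbb{Q}[x_1,\dots,x_n]$, $\alpha\in\mathbb{Z}_{\ge 0}^n$, are the unique family such that $\mathcal{K}_\alpha=x^\alpha$ if $\alpha_1\ge\dots\ge\alpha_n$, and $\mathcal{K}_{s_i(\alpha)}=\xi_i(\mathcal{K}_\alpha)$ whenever $\alpha_i>\alpha_{i+1}$. Let $\mathrm{Par}$ be the set of all partitions, let $r\ge 0$, and let $X_i=\{x_{i,1},x_{i,2},\dots\}$ for $1\le i\le r$ be infinite sets of variables. For $\lambda=(\lambda^{(1)}|\cdots|\lambda^{(r)})\in\mathrm{Par}^r$ and $n_i\ge\ell(\lambda^{(i)})$ put $$\mathcal{S}_{\lambda}^{(n_1|\cdots|n_r)}=\mathcal{K}_{(0^{n_1-\ell(\lambda^{(1)})}*\mathrm{rev}(\lambda^{(1)}))*\cdots*(0^{n_r-\ell(\lambda^{(r)})}*\mathrm{rev}(\lambda^{(r)}))}(x_{1,1},\dots,x_{1,n_1},\dots,x_{r,1},\dots,x_{r,n_r}),$$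 where $*$ is concatenation and $\mathrm{rev}$ reverses a sequence, and let $\mathcal{S}_\lambda=\lim_{n_1,\dots,n_r\to\infty}\mathcal{S}_\lambda^{(n_1|\cdots|n_r)}$, a limit of formal power series (every coefficient is eventually constant). Let $m_\mu=m_{\mu^{(1)}}(X_1)\cdots m_{\mu^{(r)}}(X_r)$ for $\mu=(\mu^{(1)}|\cdots|\mu^{(r)})\in\mathrm{Par}^r$, where $m_{\mu^{(i)}}(X_i)$ is the monomial symmetric function, and let the multi-symmetric Kostka coefficients $K^\lambda_\mu$ be defined by the finite expansion $\mathcal{S}_\lambda=\sum_{\mu\in\mathrm{Par}^r}K^\lambda_\mu m_\mu$. For $\mu,\lambda\in\mathrm{Par}$ write $\mu<_L\lambda$ if there is $k\ge 1$ with $\mu_i=\lambda_i$ for all $i<k$ and $\mu_k<\lambda_k$ (partitions being extended by zeros). For $\mu,\lambda\in\mathrm{Par}^r$ write $\mu\prec\lambda$ if there is $1\le k\le r$ with $\mu^{(i)}=\lambda^{(i)}$ for all $i>k$ and $\mu^{(k)}<_L\lambda^{(k)}$. Theorem. For every $\lambda\in\mathrm{Par}^r$ the limit $\mathcal{S}_\lambda$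 exists, the coefficients $K^\lambda_\mu$ exist and are uniquely determined (with only finitely many nonzero), and $$\mathcal{S}_{\lambda}=m_{\lambda}+\sum_{\mu\prec\lambda}K^\lambda_\mu\, m_\mu .$$ -/

import Mathlib

namespace MultiSchur

open MvPolynomial Filter

noncomputable section

section KeyPolynomials

variable {n : ℕ}

/-- `x f(x,y) - y f(y,x)` is divisible by `x - y` (with `x`, `y` two of the variables). -/
theorem sub_dvd_xi (i j : Fin n) (f : MvPolynomial (Fin n) ℚ) :
    (X i - X j : MvPolynomial (Fin n) ℚ) ∣ X i * f - X j * rename (Equiv.swap i j) f := by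
  have key : (X i - X j : MvPolynomial (Fin n) ℚ) ∣ f - rename (Equiv.swap i j) f := by
    rw [← Ideal.mem_span_singleton, ← Ideal.Quotient.eq]
    set I := Ideal.span {(X i - X j : MvPolynomial (Fin n) ℚ)} with hI
    have hij : Ideal.Quotient.mk I (X i) = Ideal.Quotient.mk I (X j) := by
      rw [Ideal.Quotient.eq, hI]
      exact Ideal.mem_span_singleton_self _
    have h : (Ideal.Quotient.mkₐ ℚ I) =
        (Ideal.Quotient.mkₐ ℚ I).comp (rename (Equiv.swap i j)) := by
      apply MvPolynomial.algHom_ext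
      intro k
      simp only [Ideal.Quotient.mkₐ_eq_mk, AlgHom.comp_apply, rename_X]
      by_cases h1 : k = i
      · subst h1; simp [hij]
      · by_cases h2 : k = j
        · subst h2; simp [hij]
        · rw [Equiv.swap_apply_of_ne_of_ne h1 h2]
    exact DFunLike.congr_fun h f
  have : X i * f - X j * rename (Equiv.swap i j) f =
      (X i - X j) * f + X j * (f - rename (Equiv.swap i j) f) := by ring
  rw [this]
  exact dvd_add (dvd_mul_right _ _) (key.mul_left _)

/-- The isobaric divided difference operator
`ξ_{x,y} f = (x f(x,y) - y f(y,x)) / (x - y)`, with `x = x_i` and `y = x_j`. -/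
def xi (i j : Fin n) (f : MvPolynomial (Fin n) ℚ) : MvPolynomial (Fin n) ℚ :=
  (sub_dvd_xi i j f).choose

theorem xi_spec (i j : Fin n) (f : MvPolynomial (Fin n) ℚ) :
    (X i - X j) * xi i j f = X i * f - X j * rename (Equiv.swap i j) f :=
  (sub_dvd_xi i j f).choose_spec.symm

/-- The two defining properties of the family of key polynomials in `n` variables. -/
structure IsKeyFamily (K : (Fin n → ℕ) → MvPolynomial (Fin n) ℚ) : Prop where
  dominant : ∀ α : Fin n → ℕ, Antitone α → K α = ∏ p, X p ^ α p
  step : ∀ (α : Fin n → ℕ) (i j : Fin n), (i : ℕ) + 1 = j → α j < α i →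
    K (α ∘ Equiv.swap i j) = xi i j (K α)

theorem X_sub_X_ne_zero {i j : Fin n} (h : i ≠ j) :
    (X i - X j : MvPolynomial (Fin n) ℚ) ≠ 0 :=
  sub_ne_zero.mpr fun e => h (X_injective e)

theorem rename_xi (e : Equiv.Perm (Fin n)) (i j : Fin n) (f : MvPolynomial (Fin n) ℚ) :
    (X (e i) - X (e j)) * rename e (xi i j f) =
      X (e i) * rename e f - X (e j) * rename (e * Equiv.swap i j) f := by
  have := congrArg (rename e) (xi_spec i j f)
  simpa [rename_rename, Equiv.Perm.coe_mul] using this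

theorem swap_comm_of_ne {i j k l : Fin n} (hik : i ≠ k) (hil : i ≠ l) (hjk : j ≠ k)
    (hjl : j ≠ l) : Equiv.swap k l * Equiv.swap i j = Equiv.swap i j * Equiv.swap k l := by
  ext p
  simp only [Equiv.Perm.coe_mul, Function.comp_apply, Equiv.swap_apply_def]
  split_ifs <;> simp_all

theorem swap_braid {i j k : Fin n} (hij : i ≠ j) (hjk : j ≠ k) (hik : i ≠ k) :
    Equiv.swap j k * (Equiv.swap i j * Equiv.swap j k) =
      Equiv.swap i j * (Equiv.swap j k * Equiv.swap i j) := by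
  ext p
  simp only [Equiv.Perm.coe_mul, Function.comp_apply, Equiv.swap_apply_def]
  split_ifs <;> simp_all

theorem xi_comm {i j k l : Fin n} (hij : i ≠ j) (hkl : k ≠ l) (hik : i ≠ k) (hil : i ≠ l)
    (hjk : j ≠ k) (hjl : j ≠ l) (f : MvPolynomial (Fin n) ℚ) :
    xi i j (xi k l f) = xi k l (xi i j f) := by
  have e1 := xi_spec i j (xi k l f)
  have e2 := xi_spec k l f
  have e3 := rename_xi (Equiv.swap i j) k l f
  have e4 := xi_spec k l (xi i j f)
  have e5 := xi_spec i j f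
  have e6 := rename_xi (Equiv.swap k l) i j f
  have c : Equiv.swap k l * Equiv.swap i j = Equiv.swap i j * Equiv.swap k l :=
    swap_comm_of_ne hik hil hjk hjl
  rw [Equiv.swap_apply_of_ne_of_ne hik.symm hjk.symm,
    Equiv.swap_apply_of_ne_of_ne hil.symm hjl.symm] at e3
  rw [Equiv.swap_apply_of_ne_of_ne hik hil, Equiv.swap_apply_of_ne_of_ne hjk hjl, c] at e6
  apply mul_left_cancel₀ (mul_ne_zero (X_sub_X_ne_zero hij) (X_sub_X_ne_zero hkl))
  linear_combination (X k - X l) * e1 + X i * e2 - X j * e3 - (X i - X j) * e4 - X k * e5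
    + X l * e6

theorem rename_swap_xi {i j : Fin n} (hij : i ≠ j) (f : MvPolynomial (Fin n) ℚ) :
    rename (Equiv.swap i j) (xi i j f) = xi i j f := by
  have h := rename_xi (Equiv.swap i j) i j f
  rw [Equiv.swap_apply_left, Equiv.swap_apply_right, Equiv.swap_mul_self] at h
  simp only [Equiv.Perm.coe_one, rename_id, AlgHom.id_apply] at h
  apply mul_left_cancel₀ (X_sub_X_ne_zero hij)
  linear_combination -h - xi_spec i j f

theorem xi_braid {i j k : Fin n} (hij : i ≠ j) (hjk : j ≠ k) (hik : i ≠ k)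
    (f : MvPolynomial (Fin n) ℚ) :
    xi i j (xi j k (xi i j f)) = xi j k (xi i j (xi j k f)) := by
  have sk : Equiv.swap i j k = k := Equiv.swap_apply_of_ne_of_ne hik.symm hjk.symm
  have ti : Equiv.swap j k i = i := Equiv.swap_apply_of_ne_of_ne hij hik
  have br : Equiv.swap j k * (Equiv.swap i j * Equiv.swap j k) =
      Equiv.swap i j * (Equiv.swap j k * Equiv.swap i j) :=
    swap_braid hij hjk hik
  have a1 := xi_spec i j (xi j k (xi i j f))
  have a2 := xi_spec j k (xi i j f)
  have a3 := rename_xi (Equiv.swap i j) j k (xi i j f)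
  have a4 := xi_spec i j f
  have a5 := rename_xi (Equiv.swap j k) i j f
  have a6 := rename_swap_xi hij f
  have a7 := rename_xi (Equiv.swap i j * Equiv.swap j k) i j f
  have b1 := xi_spec j k (xi i j (xi j k f))
  have b2 := xi_spec i j (xi j k f)
  have b3 := rename_xi (Equiv.swap j k) i j (xi j k f)
  have b4 := xi_spec j k f
  have b5 := rename_xi (Equiv.swap i j) j k f
  have b6 := rename_swap_xi hjk f
  have b7 := rename_xi (Equiv.swap j k * Equiv.swap i j) j k f
  simp only [Equiv.Perm.mul_apply, Equiv.swap_apply_left, Equiv.swap_apply_right, sk, ti,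
    mul_assoc, br] at a3 a5 a7 b3 b5 b7
  apply mul_left_cancel₀ (mul_ne_zero (mul_ne_zero (X_sub_X_ne_zero hij) (X_sub_X_ne_zero hjk))
    (X_sub_X_ne_zero hik))
  linear_combination (X j - X k) * (X i - X k) * a1 + X i * (X i - X k) * a2
    - X j * (X j - X k) * a3 + X i * X j * a4 - X i * X k * a5
    - X j * X i * (X j - X k) * a6 + X j * X k * a7
    - (X i - X j) * (X i - X k) * b1 - X j * (X i - X k) * b2 + X k * (X i - X j) * b3
    - X i ^ 2 * b4 + X j ^ 2 * b5 + X k * X i * (X i - X j) * b6 - X k ^ 2 * b7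

/-- An auxiliary weight that drops when an ascent is removed. -/
def wt (α : Fin n → ℕ) : ℕ := ∑ p : Fin n, (p : ℕ) * α p

theorem wt_swap_lt (α : Fin n → ℕ) {i j : Fin n} (hij : (i : ℕ) + 1 = j) (h : α i < α j) :
    wt (α ∘ Equiv.swap i j) < wt α := by
  have hne : i ≠ j := by rintro rfl; omega
  have hj : j ∈ Finset.univ.erase i := by simp [hne.symm]
  unfold wt
  rw [← Finset.add_sum_erase _ _ (Finset.mem_univ i), ← Finset.add_sum_erase _ _ hj,
    ← Finset.add_sum_erase (a := i) _ (fun p : Fin n => (p : ℕ) * α p) (Finset.mem_univ i),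
    ← Finset.add_sum_erase _ (fun p : Fin n => (p : ℕ) * α p) hj]
  have : ∑ x ∈ (Finset.univ.erase i).erase j, (x : ℕ) * (α ∘ Equiv.swap i j) x =
      ∑ x ∈ (Finset.univ.erase i).erase j, (x : ℕ) * α x := by
    refine Finset.sum_congr rfl fun x hx => ?_
    simp only [Finset.mem_erase, Finset.mem_univ, and_true] at hx
    rw [Function.comp_apply, Equiv.swap_apply_of_ne_of_ne hx.2 hx.1]
  rw [this]
  simp only [Function.comp_apply, Equiv.swap_apply_left, Equiv.swap_apply_right, ← hij]
  nlinarith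

open Classical in
/-- Auxiliary recursive construction of the key polynomials: remove ascents one at a time. -/
def keyAux (α : Fin n → ℕ) : MvPolynomial (Fin n) ℚ :=
  if h : ∃ p : Fin n × Fin n, (p.1 : ℕ) + 1 = p.2 ∧ α p.1 < α p.2 then
    xi h.choose.1 h.choose.2 (keyAux (α ∘ Equiv.swap h.choose.1 h.choose.2))
  else ∏ p, X p ^ α p
termination_by wt α
decreasing_by exact wt_swap_lt α h.choose_spec.1 h.choose_spec.2

theorem keyAux_ascent (N : ℕ) : ∀ (α : Fin n → ℕ), wt α < N → ∀ (i j : Fin n),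
    (i : ℕ) + 1 = j → α i < α j → keyAux α = xi i j (keyAux (α ∘ Equiv.swap i j)) := by
  induction N with
  | zero => intro α h; omega
  | succ N ih =>
    intro α hα
    have diamond : ∀ i j k : Fin n, (i : ℕ) + 1 = j → (j : ℕ) + 1 = k → α i < α j → α j < α k →
        xi i j (keyAux (α ∘ Equiv.swap i j)) = xi j k (keyAux (α ∘ Equiv.swap j k)) := by
      intro i j k hij hjk h1 h2
      have nij : i ≠ j := by rintro rfl; omega
      have njk : j ≠ k := by rintro rfl; omega
      have nik : i ≠ k := by rintro rfl; omega
      have sk : Equiv.swap i j k = k := Equiv.swap_apply_of_ne_of_ne nik.symm njk.symm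
      have ti : Equiv.swap j k i = i := Equiv.swap_apply_of_ne_of_ne nij nik
      have w1 := wt_swap_lt α hij h1
      have w2 := wt_swap_lt α hjk h2
      have l1 : (α ∘ Equiv.swap i j) j < (α ∘ Equiv.swap i j) k := by simp [sk]; omega
      have l2 : (α ∘ Equiv.swap j k) i < (α ∘ Equiv.swap j k) j := by simp [ti]; omega
      have w3 := wt_swap_lt _ hjk l1
      have w4 := wt_swap_lt _ hij l2
      have l3 : ((α ∘ Equiv.swap i j) ∘ Equiv.swap j k) i <
          ((α ∘ Equiv.swap i j) ∘ Equiv.swap j k) j := by simp [sk, ti]; omega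
      have l4 : ((α ∘ Equiv.swap j k) ∘ Equiv.swap i j) j <
          ((α ∘ Equiv.swap j k) ∘ Equiv.swap i j) k := by simp [sk, ti]; omega
      rw [ih _ (by omega) j k hjk l1, ih _ (by omega) i j hij l3,
        ih _ (by omega) i j hij l2, ih _ (by omega) j k hjk l4, xi_braid nij njk nik]
      congr 4
      funext p
      exact congrArg α (Equiv.congr_fun (swap_braid nij njk nik).symm p)
    intro i j hij h
    have hex : ∃ p : Fin n × Fin n, (p.1 : ℕ) + 1 = p.2 ∧ α p.1 < α p.2 := ⟨(i, j), hij, h⟩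
    rw [keyAux, dif_pos hex]
    obtain ⟨hkl, h'⟩ := hex.choose_spec
    generalize hex.choose = q at hkl h' ⊢
    obtain ⟨k, l⟩ := q
    simp only at hkl h' ⊢
    by_cases c1 : k = i
    · obtain rfl : l = j := by ext; subst c1; omega
      rw [c1]
    by_cases c2 : l = i
    · subst c2
      exact diamond k l j hkl hij h' h
    by_cases c3 : j = k
    · subst c3
      exact (diamond i j l hij hkl h h').symm
    have nij : i ≠ j := by rintro rfl; omega
    have nkl : k ≠ l := by rintro rfl; omega
    have njl : j ≠ l := by rintro rfl; exact c1 (by ext; omega)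
    have l1 : (α ∘ Equiv.swap k l) i < (α ∘ Equiv.swap k l) j := by
      simp only [Function.comp_apply]
      rwa [Equiv.swap_apply_of_ne_of_ne (Ne.symm c1) (Ne.symm c2),
        Equiv.swap_apply_of_ne_of_ne c3 njl]
    have l2 : (α ∘ Equiv.swap i j) k < (α ∘ Equiv.swap i j) l := by
      simp only [Function.comp_apply]
      rwa [Equiv.swap_apply_of_ne_of_ne c1 (Ne.symm c3),
        Equiv.swap_apply_of_ne_of_ne c2 njl.symm]
    have w1 := wt_swap_lt α hkl h'
    have w2 := wt_swap_lt α hij h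
    rw [ih _ (by omega) i j hij l1, ih _ (by omega) k l hkl l2,
      xi_comm nkl nij c1 (Ne.symm c3) c2 njl.symm]
    congr 3
    funext p
    exact congrArg α (Equiv.congr_fun
      (swap_comm_of_ne (Ne.symm c1) (Ne.symm c2) c3 njl) p)

theorem antitone_of_no_ascent (α : Fin n → ℕ)
    (h : ¬ ∃ p : Fin n × Fin n, (p.1 : ℕ) + 1 = p.2 ∧ α p.1 < α p.2) : Antitone α := by
  cases n with
  | zero => intro a; exact a.elim0
  | succ m =>
    rw [Fin.antitone_iff_succ_le]
    intro i
    by_contra hc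
    exact h ⟨(i.castSucc, i.succ), by simp, not_le.mp hc⟩

/-- There is exactly one family of key polynomials in `n` variables. -/
theorem existsUnique_isKeyFamily (n : ℕ) :
    ∃! K : (Fin n → ℕ) → MvPolynomial (Fin n) ℚ, IsKeyFamily K := by
  refine ⟨keyAux, ⟨fun α hα => ?_, fun α i j hij h => ?_⟩, fun K hK => ?_⟩
  · rw [keyAux, dif_neg]
    rintro ⟨⟨p, q⟩, hpq, hlt⟩
    exact absurd (hα (show p ≤ q from Fin.le_def.mpr (by simp only at hpq; omega)))
      (not_le.mpr hlt)
  · have := keyAux_ascent _ (α ∘ Equiv.swap i j) (Nat.lt_succ_self _) i j hij (by simpa using h)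
    rw [this, Function.comp_assoc]
    congr 2
    funext p
    simp
  · suffices H : ∀ N, ∀ α : Fin n → ℕ, wt α < N → K α = keyAux α from
      funext fun α => H _ α (Nat.lt_succ_self _)
    intro N
    induction N with
    | zero => intro α h; omega
    | succ N ih =>
      intro α hα
      rw [keyAux]
      split_ifs with hex
      · obtain ⟨hij, h⟩ := hex.choose_spec
        have w := wt_swap_lt α hij h
        rw [← ih _ (by omega), ← hK.step _ _ _ hij (by simpa using h), Function.comp_assoc]
        congr 1
        funext p
        simp
      · exact hK.dominant α (antitone_of_no_ascent α hex)

/-- The key polynomial `𝒦_α(x_1, …, x_n)`. -/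
def keyPoly (α : Fin n → ℕ) : MvPolynomial (Fin n) ℚ :=
  (existsUnique_isKeyFamily n).choose α

theorem isKeyFamily_keyPoly : IsKeyFamily (keyPoly (n := n)) :=
  (existsUnique_isKeyFamily n).choose_spec.1

end KeyPolynomials

/-- A partition: a weakly decreasing, finitely supported sequence `λ_1 ≥ λ_2 ≥ …` of natural
numbers, i.e. the parts followed by infinitely many zeros (`parts 0` is the largest part). -/
@[ext]
structure Par where
  parts : ℕ →₀ ℕ
  anti : Antitone parts

/-- The lexicographic order on partitions: the first differing part decides. -/
def Par.LexLT (μ lam : Par) : Prop :=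
  ∃ k, (∀ i < k, μ.parts i = lam.parts i) ∧ μ.parts k < lam.parts k

/-- The order `≺` on `r`-tuples of partitions: the last differing component decides,
by the lexicographic order on partitions. -/
def Prec {r : ℕ} (μ lam : Fin r → Par) : Prop :=
  ∃ k, (∀ i, k < i → μ i = lam i) ∧ (μ k).LexLT (lam k)

/-- The composition `(0^{n_1-ℓ(λ^1)} * rev λ^1) * ⋯ * (0^{n_r-ℓ(λ^r)} * rev λ^r)` of length
`n_1 + ⋯ + n_r` (for `n_i ≥ ℓ(λ^i)`): the `j`-th entry from the right of the `i`-th window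
is the `j`-th part of `λ^i`. -/
def windowComp {r : ℕ} (lam : Fin r → Par) (n : Fin r → ℕ) : Fin (∑ i, n i) → ℕ :=
  fun p => (lam (finSigmaFinEquiv.symm p).1).parts (Fin.rev (finSigmaFinEquiv.symm p).2)

/-- The multi-symmetric Schur polynomial `𝒮_λ^{(n_1|…|n_r)}`. Its variables are
`x_{i,1}, …, x_{i,n_i}` for `i = 1, …, r`, in this order; `x_{i,j+1}` is the variable
with index `(i, j)`. -/
def multiSchurPoly {r : ℕ} (lam : Fin r → Par) (n : Fin r → ℕ) :
    MvPolynomial (Fin r × ℕ) ℚ :=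
  rename (fun p => ((finSigmaFinEquiv.symm p).1, ((finSigmaFinEquiv.symm p).2 : ℕ)))
    (keyPoly (windowComp lam n))

/-- `f` is the limit, as a formal power series, of the polynomials `F (n_1, …, n_r)` as
`n_1, …, n_r → ∞`: each coefficient is eventually constant, with the value given by `f`. -/
def IsFormalLimit {r : ℕ} {σ : Type*} (F : (Fin r → ℕ) → MvPolynomial σ ℚ)
    (f : MvPowerSeries σ ℚ) : Prop :=
  ∀ d : σ →₀ ℕ, ∀ᶠ n in atTop, MvPolynomial.coeff d (F n) = MvPowerSeries.coeff d f

open Classical in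
/-- The multi-symmetric Schur function `𝒮_λ(X_1|…|X_r)`, as a formal power series in the
variables `x_{i,j}`: the limit of the multi-symmetric Schur polynomials. -/
def multiSchur {r : ℕ} (lam : Fin r → Par) : MvPowerSeries (Fin r × ℕ) ℚ :=
  if h : ∃ f, IsFormalLimit (multiSchurPoly lam) f then h.choose else 0

open Classical in
/-- The monomial symmetric function `m_λ(X_i)` in the `i`-th set of variables: the sum of all
distinct monomials whose exponent sequence is a rearrangement of `λ`. -/
def monomialSym {r : ℕ} (i : Fin r) (lam : Par) : MvPowerSeries (Fin r × ℕ) ℚ :=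
  fun d => if ∃ w : Equiv.Perm ℕ, d = lam.parts.mapDomain (fun j => (i, w j)) then 1 else 0

/-- The monomial multi-symmetric function `m_λ = m_{λ^1}(X_1) ⋯ m_{λ^r}(X_r)`. -/
def multiMonomial {r : ℕ} (lam : Fin r → Par) : MvPowerSeries (Fin r × ℕ) ℚ :=
  ∏ i, monomialSym i (lam i)

/-- `c` is a (finite) expansion of `f` into monomial multi-symmetric functions,
`f = ∑_μ c_μ m_μ`. -/
def IsMonomialExpansion {r : ℕ} (f : MvPowerSeries (Fin r × ℕ) ℚ)
    (c : (Fin r → Par) →₀ ℚ) : Prop :=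
  f = ∑ μ ∈ c.support, c μ • multiMonomial μ

open Classical in
/-- The multi-symmetric Kostka coefficients `K^λ_μ`: the coefficients in the expansion of
`𝒮_λ` into monomial multi-symmetric functions. -/
def kostka {r : ℕ} (lam : Fin r → Par) : (Fin r → Par) →₀ ℚ :=
  if h : ∃ c, IsMonomialExpansion (multiSchur lam) c then h.choose else 0

end

end MultiSchur

/-!
Extracting from `𝒦_α` the coefficient of a fixed monomial in some of the variables, a polynomial in
the remaining ones, commutes with the operators `ξ_i` acting on remaining variables. By induction
on the construction of `𝒦_α` from a dominant composition this gives two slicing rules. First,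
setting variables `x_p` with `α_p = 0` to zero turns `𝒦_α` into the key polynomial of `α` with
these entries deleted. Second, if `α_q` is the largest of the `α_p` with `p ≥ q`, then it bounds the
degree of `𝒦_α` in `x_q`, and the coefficient of `x_q ^ α_q` is the key polynomial of `α` with
`α_q` deleted.

The first rule makes the coefficients of `𝒮_λ^{(n_1|…|n_r)}` independent of the `n_i` once these
are large. The second rule, applied to the last variable repeatedly, shows that `x^α` has
coefficient `1` in `𝒦_α` and that every other exponent `β` occurring in `𝒦_α` satisfies `β_k < α_k`
at the last position `k` where it differs from `α`; on the reversed partitions this is the order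
`≺`.

Finally `𝒦_α` is symmetric in `x_i` and `x_{i+1}` whenever `α_i ≤ α_{i+1}`: for `α_i < α_{i+1}`
because it is in the image of `ξ_i`, and for `α_i = α_{i+1}` by the braid relations. Thus `𝒮_λ` is
symmetric in each set of variables, and it is a finite combination of the `m_μ` because `ξ_i` does
not raise the total degree.
-/

namespace MultiSchur

open MvPolynomial Filter

noncomputable section

section DividedDifference

variable {n : ℕ} {i j : Fin n}

theorem xi_eq_self (hij : i ≠ j) {f : MvPolynomial (Fin n) ℚ}
    (hf : rename (Equiv.swap i j) f = f) : xi i j f = f :=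
  mul_left_cancel₀ (X_sub_X_ne_zero hij) (by rw [xi_spec, hf, sub_mul])

theorem xi_xi (hij : i ≠ j) (f : MvPolynomial (Fin n) ℚ) : xi i j (xi i j f) = xi i j f :=
  xi_eq_self hij (rename_swap_xi hij f)

theorem single_mem_support_X_sub_X (hij : i ≠ j) :
    Finsupp.single i 1 ∈ (X i - X j : MvPolynomial (Fin n) ℚ).support := by
  simp [coeff_X, Finsupp.single_left_inj, hij.symm]

theorem totalDegree_xi_le (hij : i ≠ j) (f : MvPolynomial (Fin n) ℚ) :
    (xi i j f).totalDegree ≤ f.totalDegree := by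
  rcases eq_or_ne (xi i j f) 0 with h0 | h0
  · simp [h0]
  have hle : ((X i - X j) * xi i j f).totalDegree ≤ 1 + f.totalDegree := by
    rw [xi_spec]
    refine (totalDegree_sub _ _).trans (max_le ?_ ?_)
    · exact (totalDegree_mul _ _).trans (by rw [totalDegree_X])
    · refine (totalDegree_mul _ _).trans ?_
      rw [totalDegree_X]
      exact Nat.add_le_add_left (totalDegree_rename_le _ _) 1
  have hdiff : 1 ≤ (X i - X j : MvPolynomial (Fin n) ℚ).totalDegree := by
    simpa [Finsupp.sum_single_index] using le_totalDegree (single_mem_support_X_sub_X hij)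
  rw [totalDegree_mul_of_isDomain (X_sub_X_ne_zero hij) h0] at hle
  omega

theorem degreeOf_X_le_degreeOf_X_sub_X (hij : i ≠ j) (k : Fin n) :
    degreeOf k (X i : MvPolynomial (Fin n) ℚ) ≤
      degreeOf k (X i - X j : MvPolynomial (Fin n) ℚ) := by
  simpa [degreeOf_X, Finsupp.single_apply, eq_comm] using
    monomial_le_degreeOf k (single_mem_support_X_sub_X hij)

theorem degreeOf_xi_le (hij : i ≠ j) (f : MvPolynomial (Fin n) ℚ) (k : Fin n) :
    degreeOf k (xi i j f) ≤ max (degreeOf k f) (degreeOf (Equiv.swap i j k) f) := by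
  rcases eq_or_ne (xi i j f) 0 with h0 | h0
  · simp [h0]
  have hrename : degreeOf k (rename (Equiv.swap i j) f) = degreeOf (Equiv.swap i j k) f := by
    rw [← degreeOf_rename_of_injective (p := f) (Equiv.swap i j).injective, Equiv.swap_apply_self]
  have hi := degreeOf_X_le_degreeOf_X_sub_X hij k
  have hj := degreeOf_X_le_degreeOf_X_sub_X hij.symm k
  rw [← neg_sub, degreeOf_neg] at hj
  have hle := degreeOf_sub_le k (X i * f) (X j * rename (Equiv.swap i j) f)
  rw [← xi_spec, degreeOf_mul_eq (X_sub_X_ne_zero hij) h0] at hle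
  have hleft := degreeOf_mul_le k (X i) f
  have hright := degreeOf_mul_le k (X j) (rename (Equiv.swap i j) f)
  omega

theorem coeff_rename_perm {σ R : Type*} [CommSemiring R] (e : Equiv.Perm σ)
    (f : MvPolynomial σ R) (d : σ →₀ ℕ) :
    coeff d (rename e f) = coeff (d.mapDomain e.symm) f := by
  rw [← coeff_rename_mapDomain e e.injective f, ← Finsupp.mapDomain_comp, e.self_comp_symm,
    Finsupp.mapDomain_id]

theorem coeff_xi_of_degreeOf_le (hij : i ≠ j) {f : MvPolynomial (Fin n) ℚ} {d : Fin n →₀ ℕ}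
    (hi : degreeOf i f ≤ d j) (hj : degreeOf j f ≤ d j) :
    coeff d (xi i j f) = coeff (d.mapDomain (Equiv.swap i j)) f := by
  have hxi : degreeOf j (xi i j f) ≤ d j :=
    (degreeOf_xi_le hij f j).trans (max_le hj (by rwa [Equiv.swap_apply_right]))
  have hvanish {g : MvPolynomial (Fin n) ℚ} (hg : degreeOf j g ≤ d j) :
      coeff (Finsupp.single j 1 + d) (X i * g) = 0 := by
    refine notMem_support_iff.mp (notMem_support_of_degreeOf_lt j ?_)
    have hmul := degreeOf_mul_le j (X i) g
    rw [degreeOf_X, if_neg hij.symm, zero_add] at hmul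
    have hd : (Finsupp.single j 1 + d : Fin n →₀ ℕ) j = 1 + d j := by simp
    omega
  have h := congrArg (coeff (Finsupp.single j 1 + d)) (xi_spec i j f)
  rw [sub_mul, coeff_sub, coeff_sub, hvanish hxi, hvanish hj, coeff_X_mul, coeff_X_mul,
    coeff_rename_perm] at h
  simpa using h

end DividedDifference

section Slice

variable {σ τ R : Type*} [CommSemiring R]

/-- The polynomial in the variables indexed by `σ` whose coefficient at `d` is the coefficient of
`f` at `u + e(d)`, where `e : σ → τ` is injective. If `u` vanishes on the image of `e`, this is
the coefficient of the monomial `x ^ u` of `f`, regarded as a polynomial in the variables outside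
the image of `e`. -/
def slice {e : σ → τ} (he : Function.Injective e) (u : τ →₀ ℕ) (f : MvPolynomial τ R) :
    MvPolynomial σ R :=
  killCompl he (f.divMonomial u)

variable {e : σ → τ} {u : τ →₀ ℕ}

theorem equivFunOnFinite_symm_eq_add_mapDomain [Finite σ] [Finite τ]
    (he : Function.Injective e) (hue : ∀ a, u (e a) = 0) {α : τ → ℕ}
    (hα : ∀ p, p ∉ Set.range e → α p = u p) :
    Finsupp.equivFunOnFinite.symm α =
      u + (Finsupp.equivFunOnFinite.symm (α ∘ e)).mapDomain e := by
  ext p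
  by_cases hp : p ∈ Set.range e
  · obtain ⟨a, rfl⟩ := hp
    simp [he, hue]
  · simp [Finsupp.mapDomain_of_notMem_range _ _ hp, hα p hp]

theorem single_apply_of_range_eq {q : τ}
    (hq : Set.range e = {q}ᶜ) (c : ℕ) (a : σ) : Finsupp.single q c (e a) = 0 :=
  Finsupp.single_eq_of_ne (show e a ∈ ({q}ᶜ : Set τ) from hq ▸ Set.mem_range_self a)

theorem single_apply_of_notMem_range {q : τ}
    (hq : Set.range e = {q}ᶜ) (α : τ → ℕ) {p : τ} (hp : p ∉ Set.range e) :
    α p = Finsupp.single q (α q) p := by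
  obtain rfl : p = q := by simpa [hq] using hp
  rw [Finsupp.single_eq_same]

variable (he : Function.Injective e)

theorem coeff_slice (u : τ →₀ ℕ) (f : MvPolynomial τ R) (d : σ →₀ ℕ) :
    coeff d (slice he u f) = coeff (u + d.mapDomain e) f := by
  rw [slice, coeff_killCompl, coeff_divMonomial]

theorem slice_sub {R : Type*} [CommRing R] (u : τ →₀ ℕ) (f g : MvPolynomial τ R) :
    slice he u (f - g) = slice he u f - slice he u g := by
  ext d
  simp only [coeff_slice, coeff_sub]

theorem slice_monomial (u : τ →₀ ℕ) (d : σ →₀ ℕ) (a : R) :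
    slice he u (monomial (u + d.mapDomain e) a) = monomial d a := by
  classical
  ext d'
  simp only [coeff_slice, coeff_monomial, add_right_inj,
    (Finsupp.mapDomain_injective he).eq_iff]

theorem slice_X_mul {i : σ} (hi : u (e i) = 0) (f : MvPolynomial τ R) :
    slice he u (X (e i) * f) = X i * slice he u f := by
  classical
  ext d
  have hd : (u + d.mapDomain e) (e i) = d i := by
    rw [Finsupp.add_apply, hi, zero_add, Finsupp.mapDomain_apply he]
  have hsub (h : d i ≠ 0) : u + d.mapDomain e - Finsupp.single (e i) 1 =
      u + (d - Finsupp.single i 1).mapDomain e := by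
    have hle : Finsupp.single i 1 ≤ d := by
      simpa [Nat.one_le_iff_ne_zero] using h
    conv_lhs => rw [← tsub_add_cancel_of_le hle, Finsupp.mapDomain_add, ← add_assoc,
      Finsupp.mapDomain_single, add_tsub_cancel_right]
  rw [coeff_slice, coeff_X_mul', coeff_X_mul']
  simp only [Finsupp.mem_support_iff, hd]
  split_ifs with h
  · rw [hsub h, coeff_slice]
  · rfl

theorem mapDomain_swap_of_apply_eq [DecidableEq τ] {i j : τ} (h : u i = u j) :
    u.mapDomain (Equiv.swap i j) = u := by
  ext p
  rw [Finsupp.mapDomain_equiv_apply, Equiv.symm_swap, Equiv.swap_apply_def]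
  split_ifs <;> simp_all

theorem slice_rename_swap [DecidableEq σ] [DecidableEq τ] {i j : σ} (h : u (e i) = u (e j))
    (f : MvPolynomial τ R) :
    slice he u (rename (Equiv.swap (e i) (e j)) f) = rename (Equiv.swap i j) (slice he u f) := by
  ext d
  simp only [coeff_slice, coeff_rename_perm, Equiv.symm_swap, Finsupp.mapDomain_add,
    mapDomain_swap_of_apply_eq h, ← Finsupp.mapDomain_comp]
  congr 3
  exact he.swap_comp i j

theorem slice_xi {m n : ℕ} {e : Fin m → Fin n} (he : Function.Injective e) {u : Fin n →₀ ℕ}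
    {i j : Fin m} (hij : i ≠ j) (hi : u (e i) = 0) (hj : u (e j) = 0)
    (f : MvPolynomial (Fin n) ℚ) :
    slice he u (xi (e i) (e j) f) = xi i j (slice he u f) := by
  refine mul_left_cancel₀ (X_sub_X_ne_zero hij) ?_
  have h := congrArg (slice he u) (xi_spec (e i) (e j) f)
  rw [sub_mul, slice_sub, slice_sub, slice_X_mul he hi, slice_X_mul he hj, slice_X_mul he hi,
    slice_X_mul he hj, slice_rename_swap he (hi.trans hj.symm)] at h
  rw [xi_spec, sub_mul, h]

theorem slice_X_mul_eq_zero {i : τ} (hi : i ∉ Set.range e) (hu : u i = 0)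
    (f : MvPolynomial τ R) : slice he u (X i * f) = 0 := by
  classical
  ext d
  rw [coeff_slice, coeff_X_mul', if_neg, coeff_zero]
  rw [Finsupp.mem_support_iff, not_not, Finsupp.add_apply, hu,
    Finsupp.mapDomain_of_notMem_range _ _ hi, add_zero]

theorem slice_xi_of_notMem_range {m n : ℕ} {e : Fin m → Fin n} (he : Function.Injective e)
    {u : Fin n →₀ ℕ} {i : Fin n} {j : Fin m} (hi : i ∉ Set.range e) (hui : u i = 0)
    (huj : u (e j) = 0) (f : MvPolynomial (Fin n) ℚ) :
    slice he u (xi i (e j) f) = slice ((Equiv.swap i (e j)).injective.comp he) u f := by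
  have hrename : slice he u (rename (Equiv.swap i (e j)) f) =
      slice ((Equiv.swap i (e j)).injective.comp he) u f := by
    ext d
    simp only [coeff_slice, coeff_rename_perm, Equiv.symm_swap, Finsupp.mapDomain_add,
      mapDomain_swap_of_apply_eq (hui.trans huj.symm), ← Finsupp.mapDomain_comp]
  refine mul_left_cancel₀ (neg_ne_zero.mpr (X_ne_zero j)) ?_
  have h := congrArg (slice he u) (xi_spec i (e j) f)
  rw [sub_mul, slice_sub, slice_sub, slice_X_mul_eq_zero he hi hui, slice_X_mul_eq_zero he hi hui,
    slice_X_mul he huj, slice_X_mul he huj, hrename] at h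
  rw [neg_mul, neg_mul, ← zero_sub, h, zero_sub]

theorem slice_single_xi {m n : ℕ} {e : Fin m → Fin n} (he : Function.Injective e) {i j : Fin n}
    (hj : j ∉ Set.range e) (hij : i ≠ j) {f : MvPolynomial (Fin n) ℚ} {c : ℕ}
    (hfi : degreeOf i f ≤ c) (hfj : degreeOf j f ≤ c) :
    slice he (Finsupp.single j c) (xi i j f) =
      slice ((Equiv.swap i j).injective.comp he) (Finsupp.single i c) f := by
  ext d
  have hdj : (Finsupp.single j c + d.mapDomain e) j = c := by
    rw [Finsupp.add_apply, Finsupp.single_eq_same,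
      Finsupp.mapDomain_of_notMem_range _ _ hj, add_zero]
  rw [coeff_slice, coeff_xi_of_degreeOf_le hij (hfi.trans_eq hdj.symm) (hfj.trans_eq hdj.symm),
    coeff_slice, Finsupp.mapDomain_add, Finsupp.mapDomain_single, Equiv.swap_apply_right,
    Finsupp.mapDomain_comp]

end Slice

section KeyPolynomialCoefficients

variable {n : ℕ}

theorem ne_of_val_add_one_eq {i j : Fin n} (hij : (i : ℕ) + 1 = j) : i ≠ j := by
  rintro rfl; omega

theorem comp_swap_comp_swap {ι κ : Type*} [DecidableEq ι] (α : ι → κ) (i j : ι) :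
    (α ∘ Equiv.swap i j) ∘ Equiv.swap i j = α := by
  ext p; simp

theorem keyPoly_of_antitone {α : Fin n → ℕ} (h : Antitone α) :
    keyPoly α = monomial (Finsupp.equivFunOnFinite.symm α) 1 := by
  rw [isKeyFamily_keyPoly.dominant α h, monomial_eq]
  simp [Finsupp.prod_fintype]

theorem keyPoly_comp_swap {β : Fin n → ℕ} {i j : Fin n} (hij : (i : ℕ) + 1 = j)
    (h : β j < β i) : keyPoly (β ∘ Equiv.swap i j) = xi i j (keyPoly β) :=
  isKeyFamily_keyPoly.step β i j hij h

theorem keyPoly_eq_xi {α : Fin n → ℕ} {i j : Fin n} (hij : (i : ℕ) + 1 = j) (h : α i < α j) :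
    keyPoly α = xi i j (keyPoly (α ∘ Equiv.swap i j)) := by
  rw [← keyPoly_comp_swap hij (by simpa using h), comp_swap_comp_swap]

theorem adjacent_swap_induction {P : (Fin n → ℕ) → Prop} (antitone : ∀ α, Antitone α → P α)
    (swap : ∀ β (i j : Fin n), (i : ℕ) + 1 = j → β j < β i →
      (∀ γ, wt γ ≤ wt β → P γ) → P (β ∘ Equiv.swap i j)) (α : Fin n → ℕ) : P α := by
  induction h : wt α using Nat.strong_induction_on generalizing α with
  | _ N ih =>
    by_cases hex : ∃ p : Fin n × Fin n, (p.1 : ℕ) + 1 = p.2 ∧ α p.1 < α p.2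
    · obtain ⟨⟨i, j⟩, hij, hlt⟩ := hex
      rw [← comp_swap_comp_swap α i j]
      exact swap _ i j hij (by simpa using hlt) fun γ hγ =>
        ih _ (h ▸ hγ.trans_lt (wt_swap_lt α hij hlt)) γ rfl
    · exact antitone α (antitone_of_no_ascent α hex)

theorem strictMono_swap_comp {m : ℕ} {e : Fin m → Fin n} (he : StrictMono e) {i j : Fin n}
    (hij : (i : ℕ) + 1 = j) (h : i ∉ Set.range e ∨ j ∉ Set.range e) :
    StrictMono (Equiv.swap i j ∘ e) := by
  intro a b hab
  have hlt := he hab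
  have hmissed : ¬ (e a = i ∧ e b = j) := by
    rintro ⟨rfl, rfl⟩
    simp at h
  simp only [Function.comp_apply, Equiv.swap_apply_def, Fin.lt_def, Fin.ext_iff] at *
  split_ifs <;> omega

theorem val_add_one_eq_of_strictMono {m : ℕ} {e : Fin m → Fin n} (he : StrictMono e)
    {a b : Fin m} (hab : (e a : ℕ) + 1 = e b) : (a : ℕ) + 1 = b := by
  have hlt : a < b := he.lt_iff_lt.mp (Fin.lt_def.mpr (by omega))
  by_contra hne
  have hsucc : (a : ℕ) + 1 < b := by have := Fin.lt_def.mp hlt; omega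
  have h₁ : e a < e ⟨a + 1, by omega⟩ := he (Fin.lt_def.mpr (Nat.lt_succ_self _))
  have h₂ : e ⟨a + 1, by omega⟩ < e b := he (Fin.lt_def.mpr hsucc)
  rw [Fin.lt_def] at h₁ h₂
  omega

theorem slice_keyPoly_of_antitone {m : ℕ} {e : Fin m → Fin n} (he : StrictMono e)
    {u : Fin n →₀ ℕ} (hue : ∀ a, u (e a) = 0) {α : Fin n → ℕ}
    (hα : ∀ p, p ∉ Set.range e → α p = u p) (hanti : Antitone α) :
    slice he.injective u (keyPoly α) = keyPoly (α ∘ e) := by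
  rw [keyPoly_of_antitone hanti, keyPoly_of_antitone (hanti.comp_monotone he.monotone),
    equivFunOnFinite_symm_eq_add_mapDomain he.injective hue hα, slice_monomial]

theorem slice_keyPoly_comp_swap {m : ℕ} {e : Fin m → Fin n} (he : StrictMono e)
    {u : Fin n →₀ ℕ} (hue : ∀ a, u (e a) = 0) {β : Fin n → ℕ} {a b : Fin m}
    (hab : (e a : ℕ) + 1 = e b) (hlt : β (e b) < β (e a))
    (h : slice he.injective u (keyPoly β) = keyPoly (β ∘ e)) :
    slice he.injective u (keyPoly (β ∘ Equiv.swap (e a) (e b))) =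
      keyPoly ((β ∘ Equiv.swap (e a) (e b)) ∘ e) := by
  have hab' := val_add_one_eq_of_strictMono he hab
  rw [keyPoly_comp_swap hab hlt,
    slice_xi he.injective (ne_of_val_add_one_eq hab') (hue a) (hue b), h,
    ← keyPoly_comp_swap (β := β ∘ e) hab' hlt, Function.comp_assoc, Function.comp_assoc,
    he.injective.swap_comp]

theorem slice_keyPoly_of_eq_zero {m : ℕ} (α : Fin n → ℕ) {e : Fin m → Fin n} (he : StrictMono e)
    (hα : ∀ p, p ∉ Set.range e → α p = 0) :
    slice he.injective 0 (keyPoly α) = keyPoly (α ∘ e) := by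
  induction α using adjacent_swap_induction generalizing e with
  | antitone α hanti => exact slice_keyPoly_of_antitone he (fun _ => rfl) hα hanti
  | swap β i j hij hlt ih =>
    have hj : j ∈ Set.range e := by
      by_contra hj
      have hβi : β i = 0 := by simpa using hα j hj
      omega
    obtain ⟨b, rfl⟩ := hj
    by_cases hi : i ∈ Set.range e
    · obtain ⟨a, rfl⟩ := hi
      refine slice_keyPoly_comp_swap he (fun _ => rfl) hij hlt (ih β le_rfl he fun p hp => ?_)
      have hp' : p ≠ e a ∧ p ≠ e b := by
        constructor <;> rintro rfl <;> simp at hp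
      simpa [Equiv.swap_apply_of_ne_of_ne hp'.1 hp'.2] using hα p hp
    · rw [keyPoly_comp_swap hij hlt, slice_xi_of_notMem_range _ hi rfl rfl, Function.comp_assoc]
      refine ih β le_rfl (strictMono_swap_comp he hij (Or.inl hi)) fun p hp => ?_
      have := hα (Equiv.swap i (e b) p) fun ⟨a, ha⟩ => hp ⟨a, by simp [ha]⟩
      simpa using this

theorem le_of_forall_comp_swap_le {β : Fin n → ℕ} {i j : Fin n} (hij : (i : ℕ) + 1 = j)
    (hβ : β j ≤ β i) {k : Fin n} {c : ℕ} (h : ∀ p, k ≤ p → (β ∘ Equiv.swap i j) p ≤ c) {p : Fin n}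
    (hp : k ≤ p ∨ Equiv.swap i j k ≤ p) : β p ≤ c := by
  have hk : (k : ℕ) ≤ p ∨ (p : ℕ) = i ∧ (k : ℕ) = j := by
    simp only [Equiv.swap_apply_def, Fin.ext_iff, Fin.le_def] at hp
    split_ifs at hp <;> omega
  have hβi (hkj : (k : ℕ) ≤ j) : β i ≤ c := by simpa using h j (Fin.le_def.mpr hkj)
  rcases eq_or_ne p i with rfl | hpi
  · exact hβi (by omega)
  rcases eq_or_ne p j with rfl | hpj
  · exact hβ.trans (hβi (by omega))
  · have hkp : k ≤ p := Fin.le_def.mpr (hk.resolve_right fun hpk => hpi (Fin.ext hpk.1))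
    simpa [Equiv.swap_apply_of_ne_of_ne hpi hpj] using h p hkp

theorem degreeOf_keyPoly_le (α : Fin n → ℕ) {k : Fin n} {c : ℕ} (h : ∀ p, k ≤ p → α p ≤ c) :
    degreeOf k (keyPoly α) ≤ c := by
  induction α using adjacent_swap_induction generalizing k with
  | antitone α hanti =>
    rw [keyPoly_of_antitone hanti, degreeOf_monomial_eq _ _ one_ne_zero]
    exact h k le_rfl
  | swap β i j hij hlt ih =>
    have hβ {p : Fin n} := le_of_forall_comp_swap_le hij hlt.le h (p := p)
    rw [keyPoly_comp_swap hij hlt]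
    exact (degreeOf_xi_le (ne_of_val_add_one_eq hij) _ _).trans <|
      max_le (ih β le_rfl fun p hp => hβ (.inl hp)) (ih β le_rfl fun p hp => hβ (.inr hp))

theorem slice_keyPoly_of_forall_le {m : ℕ} (α : Fin n → ℕ) {e : Fin m → Fin n}
    (he : StrictMono e) {q : Fin n} (hq : Set.range e = {q}ᶜ) (hα : ∀ p, q ≤ p → α p ≤ α q) :
    slice he.injective (Finsupp.single q (α q)) (keyPoly α) = keyPoly (α ∘ e) := by
  induction α using adjacent_swap_induction generalizing e q with
  | antitone α hanti =>
    exact slice_keyPoly_of_antitone he (single_apply_of_range_eq hq _)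
      (fun _ => single_apply_of_notMem_range hq α) hanti
  | swap β i j hij hlt ih =>
    have hqi : q ≠ i := by
      rintro rfl
      exact hlt.not_ge (by simpa using hα j (Fin.le_def.mpr (by omega)))
    have hβ {p : Fin n} := le_of_forall_comp_swap_le hij hlt.le hα (p := p)
    rcases eq_or_ne q j with rfl | hqj
    · have hswap : Set.range (Equiv.swap i q ∘ e) = {i}ᶜ := by
        rw [Set.range_comp, hq, Set.image_compl_eq (Equiv.bijective _)]
        simp
      have hmono : StrictMono (Equiv.swap i q ∘ e) :=
        strictMono_swap_comp he hij (.inr (by simp [hq]))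
      simp only [Function.comp_apply, Equiv.swap_apply_right] at hβ ⊢
      rw [keyPoly_comp_swap hij hlt, slice_single_xi he.injective (by simp [hq])
        (ne_of_val_add_one_eq hij)
        (degreeOf_keyPoly_le β fun p hp => hβ (.inr (by simpa using hp)))
        (degreeOf_keyPoly_le β fun p hp => hβ (.inl hp)), Function.comp_assoc]
      exact ih β le_rfl hmono hswap fun p hp => hβ (.inr (by simpa using hp))
    · obtain ⟨a, rfl⟩ : i ∈ Set.range e := by simpa [hq] using hqi.symm
      obtain ⟨b, rfl⟩ : j ∈ Set.range e := by simpa [hq] using hqj.symm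
      have hfix : Equiv.swap (e a) (e b) q = q := Equiv.swap_apply_of_ne_of_ne hqi hqj
      simp only [Function.comp_apply, hfix] at hβ ⊢
      exact slice_keyPoly_comp_swap he (single_apply_of_range_eq hq _) hij hlt
        (ih β le_rfl he hq fun p hp => hβ (.inl hp))

theorem totalDegree_keyPoly_le (α : Fin n → ℕ) : (keyPoly α).totalDegree ≤ ∑ p, α p := by
  induction α using adjacent_swap_induction with
  | antitone α hanti =>
    rw [keyPoly_of_antitone hanti, totalDegree_monomial _ one_ne_zero,
      Finsupp.sum_fintype _ _ (by simp)]
    simp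
  | swap β i j hij hlt ih =>
    rw [keyPoly_comp_swap hij hlt]
    refine ((totalDegree_xi_le (ne_of_val_add_one_eq hij) _).trans (ih β le_rfl)).trans_eq ?_
    exact (Equiv.sum_comp (Equiv.swap i j) β).symm

theorem coeff_keyPoly_of_last_eq {α β : Fin (n + 1) → ℕ}
    (h : β (Fin.last n) = α (Fin.last n)) :
    coeff (Finsupp.equivFunOnFinite.symm β) (keyPoly α) =
      coeff (Finsupp.equivFunOnFinite.symm (β ∘ Fin.castSucc)) (keyPoly (α ∘ Fin.castSucc)) := by
  have hrange : Set.range (Fin.castSucc (n := n)) = {Fin.last n}ᶜ := by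
    rw [← Fin.succAbove_last, Fin.range_succAbove]
  rw [equivFunOnFinite_symm_eq_add_mapDomain (Fin.castSucc_injective n)
    (single_apply_of_range_eq hrange _) (fun _ => single_apply_of_notMem_range hrange β), h,
    ← coeff_slice Fin.strictMono_castSucc.injective,
    slice_keyPoly_of_forall_le α Fin.strictMono_castSucc hrange]
  intro p hp
  rw [Fin.last_le_iff.mp hp]

theorem coeff_keyPoly_self (α : Fin n → ℕ) :
    coeff (Finsupp.equivFunOnFinite.symm α) (keyPoly α) = 1 := by
  induction n with
  | zero => rw [keyPoly_of_antitone (Subsingleton.antitone α), coeff_monomial, if_pos rfl]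
  | succ n ih => rw [coeff_keyPoly_of_last_eq rfl, ih]

theorem eq_or_lt_of_coeff_keyPoly_ne_zero {α β : Fin n → ℕ}
    (h : coeff (Finsupp.equivFunOnFinite.symm β) (keyPoly α) ≠ 0) :
    β = α ∨ ∃ k, (∀ p, k < p → β p = α p) ∧ β k < α k := by
  induction n with
  | zero => exact .inl (Subsingleton.elim _ _)
  | succ n ih =>
    have hle : β (Fin.last n) ≤ α (Fin.last n) :=
      (monomial_le_degreeOf (Fin.last n) (mem_support_iff.mpr h)).trans <|
        degreeOf_keyPoly_le α fun p hp => by rw [Fin.last_le_iff.mp hp]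
    rcases hle.lt_or_eq with hlt | heq
    · exact .inr ⟨Fin.last n, fun p hp => absurd hp (Fin.le_last p).not_gt, hlt⟩
    rw [coeff_keyPoly_of_last_eq heq] at h
    rcases ih h with hβ | ⟨k, hk, hlt⟩
    · exact .inl (funext fun p => Fin.lastCases heq (congrFun hβ) p)
    · exact .inr ⟨k.castSucc, fun p => Fin.lastCases (fun _ => heq)
        (fun p hp => hk p (Fin.castSucc_lt_castSucc_iff.mp hp)) p, hlt⟩

end KeyPolynomialCoefficients

section KeyPolynomialSymmetry

variable {n : ℕ}

theorem xi_braid_left_of_xi_eq {i j k : Fin n} (hij : i ≠ j) (hjk : j ≠ k) (hik : i ≠ k)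
    {g : MvPolynomial (Fin n) ℚ} (hg : xi j k g = g) :
    xi i j (xi j k (xi i j g)) = xi j k (xi i j g) := by
  rw [xi_braid hij hjk hik, hg]

theorem xi_braid_right_of_xi_eq {i j k : Fin n} (hij : i ≠ j) (hjk : j ≠ k) (hik : i ≠ k)
    {g : MvPolynomial (Fin n) ℚ} (hg : xi i j g = g) :
    xi j k (xi i j (xi j k g)) = xi i j (xi j k g) := by
  rw [← xi_braid hij hjk hik, hg]

theorem xi_keyPoly_of_eq (α : Fin n → ℕ) {i j : Fin n} (hij : (i : ℕ) + 1 = j)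
    (h : α i = α j) : xi i j (keyPoly α) = keyPoly α := by
  have nij := ne_of_val_add_one_eq hij
  induction α using adjacent_swap_induction generalizing i j with
  | antitone α hα =>
    refine xi_eq_self nij ?_
    rw [keyPoly_of_antitone hα, rename_monomial, mapDomain_swap_of_apply_eq (by simpa using h)]
  | swap β k l hkl hlt ih =>
    have nkl := ne_of_val_add_one_eq hkl
    have nki : k ≠ i := by
      rintro rfl
      obtain rfl : l = j := Fin.ext (by omega)
      simp only [Function.comp_apply, Equiv.swap_apply_left, Equiv.swap_apply_right] at h
      omega
    have njl : j ≠ l := fun hjl => nki (Fin.ext (by rw [Fin.ext_iff] at hjl; omega))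
    rw [keyPoly_comp_swap hkl hlt]
    rcases eq_or_ne l i with rfl | nli
    · have nkj : k ≠ j := fun hkj => by rw [Fin.ext_iff] at hkj; omega
      have hjk : β k = β j := by
        simpa [Equiv.swap_apply_of_ne_of_ne nkj.symm njl] using h
      have hlj : β l < β j := hlt.trans_eq hjk
      rw [keyPoly_eq_xi hij hlj]
      refine xi_braid_right_of_xi_eq nkl nij nkj (ih _ (wt_swap_lt β hij hlj).le hkl ?_ nkl)
      simpa [Equiv.swap_apply_of_ne_of_ne nkl nkj] using hjk
    rcases eq_or_ne j k with rfl | njk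
    · have nil : i ≠ l := nli.symm
      have hil : β i = β l := by
        simpa [Equiv.swap_apply_of_ne_of_ne nij nil] using h
      have hi_lt : β i < β j := hil.trans_lt hlt
      rw [keyPoly_eq_xi hij hi_lt]
      refine xi_braid_left_of_xi_eq nij nkl nil (ih _ (wt_swap_lt β hij hi_lt).le hkl ?_ nkl)
      simpa [Equiv.swap_apply_of_ne_of_ne nil.symm njl.symm] using hil
    · have hβ : β i = β j := by
        simpa [Equiv.swap_apply_of_ne_of_ne nki.symm nli.symm,
          Equiv.swap_apply_of_ne_of_ne njk njl] using h
      rw [← ih β le_rfl hij hβ nij, xi_comm nkl nij nki njk.symm nli njl.symm, xi_xi nij]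

theorem rename_swap_keyPoly_of_le {α : Fin n → ℕ} {i j : Fin n} (hij : (i : ℕ) + 1 = j)
    (h : α i ≤ α j) : rename (Equiv.swap i j) (keyPoly α) = keyPoly α := by
  have nij := ne_of_val_add_one_eq hij
  rcases h.lt_or_eq with hlt | heq
  · rw [keyPoly_eq_xi hij hlt, rename_swap_xi nij]
  · rw [← xi_keyPoly_of_eq α hij heq, rename_swap_xi nij]

/-- The permutations of the variables that leave the polynomial `f` unchanged. -/
def symmetries {σ R : Type*} [CommSemiring R] (f : MvPolynomial σ R) :
    Submonoid (Equiv.Perm σ) where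
  carrier := {π | rename π f = f}
  one_mem' := by simp
  mul_mem' {π ρ} (hπ : rename π f = f) (hρ : rename ρ f = f) := by
    rw [Set.mem_ofPred_eq, Equiv.Perm.coe_mul, ← rename_rename, hρ, hπ]

theorem submonoid_perm_eq_top_of_adjacent_swap_mem {S : Submonoid (Equiv.Perm (Fin n))}
    (h : ∀ i j : Fin n, (i : ℕ) + 1 = j → Equiv.swap i j ∈ S) : S = ⊤ := by
  cases n with
  | zero => exact Subsingleton.elim _ _
  | succ n =>
    rw [eq_top_iff, ← Equiv.Perm.mclosure_swap_castSucc_succ, Submonoid.closure_le]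
    rintro _ ⟨i, rfl⟩
    exact h _ _ rfl

/-- The permutation of the `n_1 + ⋯ + n_r` positions that acts on each of the `r` consecutive
windows, of lengths `n_1, …, n_r`, by the given permutation of that window. -/
def blockPerm {r : ℕ} (n : Fin r → ℕ) :
    (∀ i, Equiv.Perm (Fin (n i))) →* Equiv.Perm (Fin (∑ i, n i)) :=
  finSigmaFinEquiv.permCongrHom.toMonoidHom.comp (Equiv.Perm.sigmaCongrRightHom _)

theorem blockPerm_apply {r : ℕ} {n : Fin r → ℕ} (π : ∀ i, Equiv.Perm (Fin (n i))) (i : Fin r)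
    (a : Fin (n i)) :
    blockPerm n π (finSigmaFinEquiv ⟨i, a⟩) = finSigmaFinEquiv ⟨i, π i a⟩ := by
  simp [blockPerm]

theorem blockPerm_mulSingle_swap {r : ℕ} {n : Fin r → ℕ} (i : Fin r) (a b : Fin (n i)) :
    blockPerm n (Pi.mulSingle i (Equiv.swap a b)) =
      Equiv.swap (finSigmaFinEquiv ⟨i, a⟩) (finSigmaFinEquiv ⟨i, b⟩) := by
  ext p
  obtain ⟨⟨k, c⟩, rfl⟩ := finSigmaFinEquiv.surjective p
  rw [blockPerm_apply, ← Function.Injective.map_swap finSigmaFinEquiv.injective]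
  rcases eq_or_ne k i with rfl | hk
  · rw [Pi.mulSingle_eq_same, ← Function.Injective.map_swap sigma_mk_injective]
  · rw [Pi.mulSingle_eq_of_ne hk, Equiv.Perm.one_apply,
      Equiv.swap_apply_of_ne_of_ne (by simp [hk]) (by simp [hk])]

theorem rename_blockPerm_keyPoly {r : ℕ} {n : Fin r → ℕ} {α : Fin (∑ i, n i) → ℕ}
    (hα : ∀ i, Monotone fun a : Fin (n i) => α (finSigmaFinEquiv ⟨i, a⟩))
    (π : ∀ i, Equiv.Perm (Fin (n i))) : rename (blockPerm n π) (keyPoly α) = keyPoly α := by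
  suffices h : π ∈ (symmetries (keyPoly α)).comap (blockPerm n) from h
  refine Submonoid.pi_mem_of_mulSingle_mem π fun i => ?_
  suffices h : ((symmetries (keyPoly α)).comap (blockPerm n)).comap
      (MonoidHom.mulSingle _ i) = ⊤ from h.ge (Submonoid.mem_top (π i))
  refine submonoid_perm_eq_top_of_adjacent_swap_mem fun a b hab => ?_
  change rename (blockPerm n (Pi.mulSingle i (Equiv.swap a b))) _ = _
  rw [blockPerm_mulSingle_swap]
  refine rename_swap_keyPoly_of_le ?_ (hα i (show a ≤ b from Fin.le_def.mpr (by omega)))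
  simp [finSigmaFinEquiv_apply, ← hab, add_assoc]

end KeyPolynomialSymmetry

section Rearrangements

/-- The sequence `g` is a rearrangement of the parts of the partition `μ`, trailing zeros
included. -/
def IsRearrangement (g : ℕ → ℕ) (μ : Par) : Prop :=
  ∃ w : Equiv.Perm ℕ, ∀ j, g (w j) = μ.parts j

theorem Par.parts_le_of_apply_perm {μ ν : Par} {w : Equiv.Perm ℕ}
    (h : ∀ j, μ.parts (w j) = ν.parts j) (k : ℕ) : ν.parts k ≤ μ.parts k := by
  by_contra! hlt
  have hmaps : ∀ j ∈ Finset.range (k + 1), w j ∈ Finset.range k := by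
    intro j hj
    have hν := ν.anti (Finset.mem_range_succ_iff.mp hj)
    by_contra hk
    have hμ := μ.anti (not_lt.mp (mt Finset.mem_range.mpr hk))
    exact absurd (hν.trans ((h j).ge.trans hμ)) (not_le.mpr hlt)
  have hcard := Finset.card_le_card_of_injOn w hmaps w.injective.injOn
  rw [Finset.card_range, Finset.card_range] at hcard
  omega

theorem IsRearrangement.unique {g : ℕ → ℕ} {μ ν : Par} (hμ : IsRearrangement g μ)
    (hν : IsRearrangement g ν) : μ = ν := by
  obtain ⟨w, hw⟩ := hμ
  obtain ⟨v, hv⟩ := hν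
  ext k
  refine le_antisymm (Par.parts_le_of_apply_perm (w := w.trans v.symm) (fun j => ?_) k)
    (Par.parts_le_of_apply_perm (w := v.trans w.symm) (fun j => ?_) k)
  · rw [← hv, ← hw, Equiv.trans_apply, Equiv.apply_symm_apply]
  · rw [← hw, ← hv, Equiv.trans_apply, Equiv.apply_symm_apply]

variable {g : ℕ → ℕ} {N : ℕ}

theorem exists_par_of_antitone_fin {f : Fin N → ℕ} (hf : Antitone f) :
    ∃ μ : Par, (∀ a : Fin N, μ.parts a = f a) ∧ ∀ j, N ≤ j → μ.parts j = 0 := by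
  let p : ℕ → ℕ := fun j => if hj : j < N then f ⟨j, hj⟩ else 0
  have hp : ∀ j, N ≤ j → p j = 0 := fun j hj => dif_neg (not_lt.mpr hj)
  refine ⟨⟨Finsupp.onFinset (Finset.range N) p fun j hj => ?_, fun a b hab => ?_⟩,
    fun a => dif_pos a.2, hp⟩
  · exact Finset.mem_range.mpr (not_le.mp (mt (hp j) hj))
  · rcases le_or_gt N b with hb | hb
    · exact (hp b hb).le.trans (Nat.zero_le _)
    · simpa [p, hb, hab.trans_lt hb] using hf (Fin.mk_le_mk.mpr hab)

theorem IsRearrangement.of_perm_fin (hg : ∀ j, N ≤ j → g j = 0) {μ : Par}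
    (hμ : ∀ j, N ≤ j → μ.parts j = 0) {π : Equiv.Perm (Fin N)}
    (hπ : ∀ a, g (π a) = μ.parts a) : IsRearrangement g μ := by
  refine ⟨π.extendDomain Fin.equivSubtype, fun j => ?_⟩
  rcases lt_or_ge j N with hj | hj
  · rw [Equiv.Perm.extendDomain_apply_subtype π Fin.equivSubtype hj]
    exact hπ ⟨j, hj⟩
  · rw [Equiv.Perm.extendDomain_apply_not_subtype π Fin.equivSubtype (not_lt.mpr hj), hg j hj,
      hμ j hj]

theorem exists_par_perm_fin (hg : ∀ j, N ≤ j → g j = 0) :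
    ∃ μ : Par, IsRearrangement g μ ∧ ∃ π : Equiv.Perm (Fin N), ∀ a, g (π a) = μ.parts a := by
  let f : Fin N → ℕᵒᵈ := fun a => OrderDual.toDual (g a)
  obtain ⟨μ, hμ, hzero⟩ := exists_par_of_antitone_fin (f := fun a : Fin N => g (Tuple.sort f a))
    (fun _ _ hab => Tuple.monotone_sort f hab)
  have hsort : ∀ a, g (Tuple.sort f a) = μ.parts a := fun a => (hμ a).symm
  exact ⟨μ, .of_perm_fin hg hzero hsort, _, hsort⟩

theorem IsRearrangement.exists_perm_fin {μ : Par} (h : IsRearrangement g μ)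
    (hg : ∀ j, N ≤ j → g j = 0) : ∃ π : Equiv.Perm (Fin N), ∀ a, g (π a) = μ.parts a := by
  obtain ⟨ν, hν, hπ⟩ := exists_par_perm_fin hg
  rwa [h.unique hν]

end Rearrangements

section MonomialFunctions

theorem coeff_prod_of_separated {ι σ R : Type*} [Fintype ι] [DecidableEq ι] [CommSemiring R]
    {b : σ → ι} {F : ι → MvPowerSeries σ R}
    (hF : ∀ i d, MvPowerSeries.coeff d (F i) ≠ 0 → ∀ p, b p ≠ i → d p = 0) (d : σ →₀ ℕ) :
    MvPowerSeries.coeff d (∏ i, F i) =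
      ∏ i, MvPowerSeries.coeff (d.filter (b · = i)) (F i) := by
  classical
  let restrictions : ι →₀ σ →₀ ℕ := Finsupp.equivFunOnFinite.symm fun i => d.filter (b · = i)
  rw [MvPowerSeries.coeff_prod, Finset.sum_eq_single restrictions]
  · rfl
  · intro l hl hne
    contrapose! hne
    have hsep : ∀ i p, b p ≠ i → l i p = 0 := fun i =>
      hF i (l i) fun h => hne (Finset.prod_eq_zero (Finset.mem_univ i) h)
    have hsum : ∀ p, l (b p) p = d p := fun p => by
      rw [← (Finset.mem_finsuppAntidiag.mp hl).1, Finsupp.finsetSum_apply]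
      exact (Finset.sum_eq_single (b p) (fun i _ hi => hsep i p hi.symm) (by simp)).symm
    ext i p
    rcases eq_or_ne (b p) i with rfl | hp
    · simp [restrictions, hsum]
    · simp [restrictions, hp, hsep i p hp]
  · refine fun h => absurd (Finset.mem_finsuppAntidiag.mpr ⟨?_, Finset.subset_univ _⟩) h
    ext p
    simp [restrictions, Finsupp.finsetSum_apply, Finsupp.filter_apply]

variable {r : ℕ}

/-- The exponent `d` has type `μ` if, for each `i`, the exponents of the variables in the `i`-th
set form a rearrangement of `μ i`; these are the exponents of the monomials of `m_μ`. -/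
def HasType (d : Fin r × ℕ →₀ ℕ) (μ : Fin r → Par) : Prop :=
  ∀ i, IsRearrangement (fun j => d (i, j)) (μ i)

theorem HasType.unique {d : Fin r × ℕ →₀ ℕ} {μ ν : Fin r → Par} (hμ : HasType d μ)
    (hν : HasType d ν) : μ = ν :=
  funext fun i => (hμ i).unique (hν i)

theorem exists_hasType_exponent (μ : Fin r → Par) : ∃ d : Fin r × ℕ →₀ ℕ, HasType d μ := by
  refine ⟨Finsupp.curryEquiv.symm
    (Finsupp.equivFunOnFinite.symm fun i => (μ i).parts), fun i => ⟨1, fun j => ?_⟩⟩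
  simp

theorem exists_eq_zero_of_le (d : Fin r × ℕ →₀ ℕ) : ∃ N, ∀ i j, N ≤ j → d (i, j) = 0 := by
  refine ⟨d.support.sup fun p => p.2 + 1, fun i j hj => ?_⟩
  by_contra h
  exact absurd hj (not_le.mpr
    (Finset.le_sup (f := fun p : Fin r × ℕ => p.2 + 1) (Finsupp.mem_support_iff.mpr h)))

theorem exists_type_of_exponent (d : Fin r × ℕ →₀ ℕ) : ∃ μ : Fin r → Par, HasType d μ := by
  obtain ⟨N, hN⟩ := exists_eq_zero_of_le d
  choose μ hμ _ using fun i => exists_par_perm_fin (hN i)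
  exact ⟨μ, hμ⟩

theorem eq_zero_of_coeff_monomialSym_ne_zero {i : Fin r} {μ : Par} {d : Fin r × ℕ →₀ ℕ}
    (h : MvPowerSeries.coeff d (monomialSym i μ) ≠ 0) (p : Fin r × ℕ) (hp : p.1 ≠ i) :
    d p = 0 := by
  obtain ⟨w, rfl⟩ : ∃ w : Equiv.Perm ℕ, d = μ.parts.mapDomain fun j => (i, w j) :=
    of_not_not fun hn => h (if_neg hn)
  refine Finsupp.mapDomain_of_notMem_range _ _ ?_
  rintro ⟨j, rfl⟩
  exact hp rfl

theorem filter_eq_mapDomain_iff (d : Fin r × ℕ →₀ ℕ) (i : Fin r) (f : ℕ →₀ ℕ)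
    (w : Equiv.Perm ℕ) :
    d.filter (·.1 = i) = f.mapDomain (fun j => (i, w j)) ↔ ∀ j, d (i, w j) = f j := by
  have hinj : Function.Injective fun j => (i, w j) :=
    (Prod.mk_right_injective i).comp w.injective
  refine ⟨fun h j => ?_, fun h => Finsupp.ext fun ⟨k, j⟩ => ?_⟩
  · simpa [hinj] using DFunLike.congr_fun h (i, w j)
  · rcases eq_or_ne k i with rfl | hk
    · obtain ⟨j, rfl⟩ := w.surjective j
      rw [Finsupp.filter_apply, if_pos rfl, h, Finsupp.mapDomain_apply hinj]
    · rw [Finsupp.filter_apply, if_neg hk, Finsupp.mapDomain_of_notMem_range]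
      rintro ⟨a, ha⟩
      exact hk (congrArg Prod.fst ha).symm

open Classical in
theorem coeff_multiMonomial (μ : Fin r → Par) (d : Fin r × ℕ →₀ ℕ) :
    MvPowerSeries.coeff d (multiMonomial μ) = if HasType d μ then 1 else 0 := by
  have hfactor : ∀ i, MvPowerSeries.coeff (d.filter (·.1 = i)) (monomialSym i (μ i)) =
      if IsRearrangement (fun j => d (i, j)) (μ i) then 1 else 0 := fun i =>
    if_congr (exists_congr fun w => filter_eq_mapDomain_iff d i (μ i).parts w) rfl rfl
  rw [multiMonomial, coeff_prod_of_separated fun i _ => eq_zero_of_coeff_monomialSym_ne_zero]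
  rw [Finset.prod_congr rfl fun i _ => hfactor i]
  split_ifs with h
  · exact Finset.prod_eq_one fun i _ => if_pos (h i)
  · obtain ⟨i, hi⟩ := not_forall.mp h
    exact Finset.prod_eq_zero (Finset.mem_univ i) (if_neg hi)

end MonomialFunctions

section Windows

variable {r : ℕ} {n n' : Fin r → ℕ} {lam μ : Fin r → Par}

theorem finSigmaFinEquiv_val (s : (i : Fin r) × Fin (n i)) :
    (finSigmaFinEquiv s : ℕ) = ∑ k ∈ Finset.Iio s.1, n k + s.2 := by
  have hIio : Finset.Iio s.1 = Finset.univ.map (Fin.castLEEmb s.1.2.le) := by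
    ext k
    simp only [Finset.mem_Iio, Finset.mem_map, Finset.mem_univ, true_and]
    exact ⟨fun hk => ⟨⟨k, hk⟩, rfl⟩, fun ⟨j, hj⟩ => hj ▸ j.2⟩
  rw [finSigmaFinEquiv_apply, hIio, Finset.sum_map]
  rfl

theorem finSigmaFinEquiv_lt_of_fst_lt {s t : (i : Fin r) × Fin (n i)} (h : s.1 < t.1) :
    finSigmaFinEquiv s < finSigmaFinEquiv t := by
  rw [Fin.lt_def, finSigmaFinEquiv_val, finSigmaFinEquiv_val]
  calc ∑ k ∈ Finset.Iio s.1, n k + s.2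
      < ∑ k ∈ Finset.Iio s.1, n k + n s.1 := Nat.add_lt_add_left s.2.2 _
    _ = ∑ k ∈ Finset.Iic s.1, n k := by
      rw [← Finset.Iio_insert, Finset.sum_insert (by simp), add_comm]
    _ ≤ ∑ k ∈ Finset.Iio t.1, n k :=
      Finset.sum_le_sum_of_subset fun _ hk =>
        Finset.mem_Iio.mpr ((Finset.mem_Iic.mp hk).trans_lt h)
    _ ≤ ∑ k ∈ Finset.Iio t.1, n k + t.2 := Nat.le_add_right _ _

theorem finSigmaFinEquiv_mk_lt_mk_iff {i : Fin r} {a b : Fin (n i)} :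
    finSigmaFinEquiv (n := n) ⟨i, a⟩ < finSigmaFinEquiv ⟨i, b⟩ ↔ a < b := by
  rw [Fin.lt_def, finSigmaFinEquiv_val, finSigmaFinEquiv_val, Fin.lt_def, add_lt_add_iff_left]

theorem finSigmaFinEquiv_lt_iff {s t : (i : Fin r) × Fin (n i)} :
    finSigmaFinEquiv s < finSigmaFinEquiv t ↔ Sigma.Lex (· < ·) (fun _ => (· < ·)) s t := by
  refine ⟨fun h => ?_, ?_⟩
  · obtain ⟨i, a⟩ := s
    obtain ⟨k, b⟩ := t
    rcases lt_trichotomy i k with hik | rfl | hki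
    · exact .left _ _ hik
    · exact .right _ _ (finSigmaFinEquiv_mk_lt_mk_iff.mp h)
    · exact absurd h (finSigmaFinEquiv_lt_of_fst_lt hki).asymm
  · rintro (⟨a, b, h⟩ | ⟨a, b, h⟩)
    · exact finSigmaFinEquiv_lt_of_fst_lt h
    · exact finSigmaFinEquiv_mk_lt_mk_iff.mpr h

theorem windowComp_apply (μ : Fin r → Par) (i : Fin r) (a : Fin (n i)) :
    windowComp μ n (finSigmaFinEquiv ⟨i, a⟩) = (μ i).parts (Fin.rev a) := by
  rw [windowComp, Equiv.symm_apply_apply]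

theorem windowComp_apply_rev (μ : Fin r → Par) {i : Fin r} {j : ℕ} (hj : j < n i) :
    windowComp μ n (finSigmaFinEquiv ⟨i, Fin.rev ⟨j, hj⟩⟩) = (μ i).parts j := by
  rw [windowComp_apply, Fin.rev_rev]

theorem monotone_windowComp (μ : Fin r → Par) (i : Fin r) :
    Monotone fun a : Fin (n i) => windowComp μ n (finSigmaFinEquiv ⟨i, a⟩) := by
  intro a b hab
  simp only [windowComp_apply]
  exact (μ i).anti (Fin.rev_le_rev.mpr hab)

/-- `n_i ≥ ℓ(μ^i)` for all `i`: the windows have room for the partitions. -/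
def Fits (μ : Fin r → Par) (n : Fin r → ℕ) : Prop :=
  ∀ i j, n i ≤ j → (μ i).parts j = 0

theorem Fits.mono (h : Fits μ n) (hn : n ≤ n') : Fits μ n' :=
  fun i j hj => h i j ((hn i).trans hj)

theorem Fits.eq_of_windowComp_eq (hμ : Fits μ n) (hlam : Fits lam n) {i : Fin r}
    (h : ∀ a, windowComp μ n (finSigmaFinEquiv ⟨i, a⟩) =
      windowComp lam n (finSigmaFinEquiv ⟨i, a⟩)) : μ i = lam i := by
  ext j
  rcases lt_or_ge j (n i) with hj | hj
  · rw [← windowComp_apply_rev μ hj, ← windowComp_apply_rev lam hj, h]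
  · rw [hμ i j hj, hlam i j hj]

theorem Fits.sum_windowComp (h : Fits μ n) :
    ∑ p, windowComp μ n p = ∑ i, (μ i).parts.degree := by
  rw [← finSigmaFinEquiv.sum_comp, Fintype.sum_sigma]
  refine Finset.sum_congr rfl fun i _ => ?_
  have hsupport : (μ i).parts.support ⊆ Finset.range (n i) := fun j hj =>
    Finset.mem_range.mpr (not_le.mp (mt (h i j) (Finsupp.mem_support_iff.mp hj)))
  calc ∑ a : Fin (n i), windowComp μ n (finSigmaFinEquiv ⟨i, a⟩)
      = ∑ a : Fin (n i), (μ i).parts (Fin.rev a) := by simp only [windowComp_apply]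
    _ = ∑ a : Fin (n i), (μ i).parts a := Equiv.sum_comp Fin.revPerm fun a => (μ i).parts a
    _ = ∑ j ∈ Finset.range (n i), (μ i).parts j := Fin.sum_univ_eq_sum_range _ _
    _ = (μ i).parts.degree :=
      (Finsupp.sum_of_support_subset _ hsupport (fun _ m => m) (by simp)).symm

/-- The embedding of smaller windows at the right ends of larger ones. -/
def windowEmb (hn : n ≤ n') (p : Fin (∑ i, n i)) : Fin (∑ i, n' i) :=
  finSigmaFinEquiv <| (finSigmaFinEquiv.symm p).map id fun i a =>
    Fin.rev (Fin.castLE (hn i) (Fin.rev a))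

theorem windowEmb_apply (hn : n ≤ n') (i : Fin r) (a : Fin (n i)) :
    windowEmb hn (finSigmaFinEquiv ⟨i, a⟩) =
      finSigmaFinEquiv ⟨i, Fin.rev (Fin.castLE (hn i) (Fin.rev a))⟩ := by
  rw [windowEmb, Equiv.symm_apply_apply]
  rfl

theorem strictMono_windowEmb (hn : n ≤ n') : StrictMono (windowEmb hn) := by
  intro p q hpq
  obtain ⟨s, rfl⟩ := finSigmaFinEquiv.surjective p
  obtain ⟨t, rfl⟩ := finSigmaFinEquiv.surjective q
  rcases finSigmaFinEquiv_lt_iff.mp hpq with ⟨a, b, h⟩ | ⟨a, b, h⟩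
  all_goals rw [windowEmb_apply, windowEmb_apply, finSigmaFinEquiv_lt_iff]
  · exact .left _ _ h
  · exact .right _ _ (by simpa [Fin.rev_lt_rev] using h)

theorem windowComp_comp_windowEmb (μ : Fin r → Par) (hn : n ≤ n') :
    windowComp μ n' ∘ windowEmb hn = windowComp μ n := by
  funext p
  obtain ⟨⟨i, a⟩, rfl⟩ := finSigmaFinEquiv.surjective p
  rw [Function.comp_apply, windowEmb_apply, windowComp_apply, windowComp_apply, Fin.rev_rev,
    Fin.val_castLE]

theorem Fits.windowComp_eq_zero (hμ : Fits μ n) (hn : n ≤ n') {p : Fin (∑ i, n' i)}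
    (hp : p ∉ Set.range (windowEmb hn)) : windowComp μ n' p = 0 := by
  obtain ⟨⟨i, a⟩, rfl⟩ := finSigmaFinEquiv.surjective p
  rw [windowComp_apply]
  refine hμ i _ (not_lt.mp fun h => hp ⟨finSigmaFinEquiv ⟨i, Fin.rev ⟨Fin.rev a, h⟩⟩, ?_⟩)
  rw [windowEmb_apply, Fin.rev_rev, Fin.castLE_mk, Fin.eta, Fin.rev_rev]

end Windows

section StableCoefficients

variable {r : ℕ} {n n' : Fin r → ℕ} {lam μ : Fin r → Par}

/-- The coefficient in `𝒮_λ^{(n_1|…|n_r)}` of the monomial whose exponents in the `i`-th set of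
variables are the parts of `μ^i` in increasing order. -/
def windowCoeff (lam μ : Fin r → Par) (n : Fin r → ℕ) : ℚ :=
  coeff (Finsupp.equivFunOnFinite.symm (windowComp μ n)) (keyPoly (windowComp lam n))

theorem windowCoeff_of_le (hlam : Fits lam n) (hμ : Fits μ n) (hn : n ≤ n') :
    windowCoeff lam μ n' = windowCoeff lam μ n := by
  have he := strictMono_windowEmb hn
  rw [windowCoeff, equivFunOnFinite_symm_eq_add_mapDomain (u := 0) he.injective (fun _ => rfl)
    fun p hp => hμ.windowComp_eq_zero hn hp, ← coeff_slice he.injective,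
    slice_keyPoly_of_eq_zero _ he fun p hp => hlam.windowComp_eq_zero hn hp,
    windowComp_comp_windowEmb, windowComp_comp_windowEmb, windowCoeff]

theorem eq_or_prec_of_windowCoeff_ne_zero (hlam : Fits lam n) (hμ : Fits μ n)
    (h : windowCoeff lam μ n ≠ 0) : μ = lam ∨ Prec μ lam := by
  refine (eq_or_lt_of_coeff_keyPoly_ne_zero h).imp
    (fun heq => funext fun i => hμ.eq_of_windowComp_eq hlam fun a => congrFun heq _) ?_
  rintro ⟨p, hp, hlt⟩
  obtain ⟨⟨k, a⟩, rfl⟩ := finSigmaFinEquiv.surjective p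
  refine ⟨k, fun i hi => hμ.eq_of_windowComp_eq hlam fun a =>
    hp _ (finSigmaFinEquiv_lt_of_fst_lt hi), Fin.rev a, fun j hj => ?_, ?_⟩
  · have hj' : j < n k := hj.trans (Fin.rev a).2
    rw [← windowComp_apply_rev μ hj', ← windowComp_apply_rev lam hj']
    exact hp _ (finSigmaFinEquiv_mk_lt_mk_iff.mpr (Fin.lt_rev_iff.mpr hj))
  · simpa only [windowComp_apply] using hlt

theorem sum_degree_le_of_windowCoeff_ne_zero (hlam : Fits lam n) (hμ : Fits μ n)
    (h : windowCoeff lam μ n ≠ 0) :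
    ∑ i, (μ i).parts.degree ≤ ∑ i, (lam i).parts.degree := by
  rw [← hlam.sum_windowComp, ← hμ.sum_windowComp]
  refine le_trans ?_ (totalDegree_keyPoly_le _)
  simpa [Finsupp.sum_fintype] using le_totalDegree (mem_support_iff.mpr h)

theorem Par.parts_eq_zero_of_degree_le (μ : Par) {j : ℕ} (h : μ.parts.degree ≤ j) :
    μ.parts j = 0 := by
  by_contra hne
  have hsubset : Finset.range (j + 1) ⊆ μ.parts.support := fun k hk =>
    Finsupp.mem_support_iff.mpr fun hk0 =>
      hne (Nat.eq_zero_of_le_zero (hk0 ▸ μ.anti (Finset.mem_range_succ_iff.mp hk)))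
  have hcard : μ.parts.support.card ≤ μ.parts.degree := by
    rw [Finsupp.degree_apply, Finset.card_eq_sum_ones]
    exact Finset.sum_le_sum fun k hk => Nat.one_le_iff_ne_zero.mpr (Finsupp.mem_support_iff.mp hk)
  have := Finset.card_le_card hsubset
  rw [Finset.card_range] at this
  omega

theorem fits_degree (μ : Fin r → Par) : Fits μ fun i => (μ i).parts.degree :=
  fun i _ hj => (μ i).parts_eq_zero_of_degree_le hj

/-- The value of `windowCoeff lam μ n` for all `n` with room for both partitions; it is computed
at `n_i = max |λ^i| |μ^i|`. -/
def stableCoeff (lam μ : Fin r → Par) : ℚ :=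
  windowCoeff lam μ ((fun i => (lam i).parts.degree) ⊔ fun i => (μ i).parts.degree)

theorem windowCoeff_eq_stableCoeff (hlam : Fits lam n) (hμ : Fits μ n) :
    windowCoeff lam μ n = stableCoeff lam μ := by
  rw [stableCoeff, ← windowCoeff_of_le hlam hμ le_sup_left, windowCoeff_of_le
    ((fits_degree lam).mono le_sup_left) ((fits_degree μ).mono le_sup_right) le_sup_right]

theorem stableCoeff_self (lam : Fin r → Par) : stableCoeff lam lam = 1 :=
  coeff_keyPoly_self _

theorem eq_or_prec_of_stableCoeff_ne_zero (h : stableCoeff lam μ ≠ 0) : μ = lam ∨ Prec μ lam :=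
  eq_or_prec_of_windowCoeff_ne_zero ((fits_degree lam).mono le_sup_left)
    ((fits_degree μ).mono le_sup_right) h

theorem sum_degree_le_of_stableCoeff_ne_zero (h : stableCoeff lam μ ≠ 0) :
    ∑ i, (μ i).parts.degree ≤ ∑ i, (lam i).parts.degree :=
  sum_degree_le_of_windowCoeff_ne_zero ((fits_degree lam).mono le_sup_left)
    ((fits_degree μ).mono le_sup_right) h

theorem finite_setOf_par_degree_le (M : ℕ) : {μ : Par | μ.parts.degree ≤ M}.Finite := by
  let bound : ℕ →₀ ℕ := Finsupp.indicator (Finset.range M) fun _ _ => M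
  have hinj : Function.Injective Par.parts := fun _ _ => Par.ext
  refine ((Set.finite_Iic bound).preimage hinj.injOn).subset fun μ hμ j => ?_
  rcases lt_or_ge j M with hj | hj
  · simpa [bound, hj] using (Finsupp.le_degree j μ.parts).trans hμ
  · exact (μ.parts_eq_zero_of_degree_le (le_trans hμ hj)).le.trans (Nat.zero_le _)

theorem finite_support_stableCoeff (lam : Fin r → Par) :
    (Function.support (stableCoeff lam)).Finite := by
  refine (Set.Finite.pi' fun _ : Fin r =>
    finite_setOf_par_degree_le (∑ i, (lam i).parts.degree)).subset fun μ hμ i => ?_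
  exact (Finset.single_le_sum (f := fun i => (μ i).parts.degree) (fun _ _ => Nat.zero_le _)
    (Finset.mem_univ i)).trans (sum_degree_le_of_stableCoeff_ne_zero hμ)

end StableCoefficients

section MultiSchurPolynomials

variable {r : ℕ} {n : Fin r → ℕ} {μ : Fin r → Par}

/-- The index `(i, j)` of the variable `x_{i,j+1}` in position `p` of the concatenated windows,
so that `multiSchurPoly lam n` is `keyPoly (windowComp lam n)` in the variables
`windowVar n p`. -/
def windowVar (n : Fin r → ℕ) (p : Fin (∑ i, n i)) : Fin r × ℕ :=
  ((finSigmaFinEquiv.symm p).1, (finSigmaFinEquiv.symm p).2)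

theorem windowVar_apply (i : Fin r) (a : Fin (n i)) :
    windowVar n (finSigmaFinEquiv ⟨i, a⟩) = (i, (a : ℕ)) := by
  rw [windowVar, Equiv.symm_apply_apply]

theorem injective_windowVar (n : Fin r → ℕ) : Function.Injective (windowVar n) := by
  intro p q h
  obtain ⟨⟨i, a⟩, rfl⟩ := finSigmaFinEquiv.surjective p
  obtain ⟨⟨k, b⟩, rfl⟩ := finSigmaFinEquiv.surjective q
  rw [windowVar_apply, windowVar_apply, Prod.mk.injEq] at h
  obtain ⟨rfl, hab⟩ := h
  rw [Fin.ext hab]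

theorem HasType.exists_blockPerm {d : Fin r × ℕ →₀ ℕ} (hd : HasType d μ)
    (hz : ∀ i j, n i ≤ j → d (i, j) = 0) :
    ∃ π : ∀ i, Equiv.Perm (Fin (n i)), ∀ p,
      d (windowVar n (blockPerm n π p)) = windowComp μ n p := by
  choose π hπ using fun i => (hd i).exists_perm_fin (hz i)
  refine ⟨fun i => Fin.revPerm.trans (π i), fun p => ?_⟩
  obtain ⟨⟨i, a⟩, rfl⟩ := finSigmaFinEquiv.surjective p
  rw [blockPerm_apply, windowVar_apply, windowComp_apply, Equiv.trans_apply, Fin.revPerm_apply,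
    hπ]

theorem coeff_multiSchurPoly {d : Fin r × ℕ →₀ ℕ} (lam : Fin r → Par) (hd : HasType d μ)
    (hz : ∀ i j, n i ≤ j → d (i, j) = 0) :
    coeff d (multiSchurPoly lam n) = windowCoeff lam μ n := by
  obtain ⟨π, hπ⟩ := hd.exists_blockPerm hz
  have hinj := (injective_windowVar n).comp (blockPerm n π).injective
  have hd_eq : d = (Finsupp.equivFunOnFinite.symm (windowComp μ n)).mapDomain
      (windowVar n ∘ blockPerm n π) := by
    ext ⟨i, j⟩
    rcases lt_or_ge j (n i) with hj | hj
    · obtain ⟨p, hp⟩ := (blockPerm n π).surjective (finSigmaFinEquiv ⟨i, ⟨j, hj⟩⟩)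
      have hij : (windowVar n ∘ blockPerm n π) p = (i, j) := by
        rw [Function.comp_apply, hp, windowVar_apply]
      rw [← hij, Finsupp.mapDomain_apply hinj]
      exact hπ p
    · rw [hz i j hj, Finsupp.mapDomain_of_notMem_range]
      rintro ⟨p, hp⟩
      obtain ⟨⟨k, b⟩, hkb⟩ := finSigmaFinEquiv.surjective (blockPerm n π p)
      rw [Function.comp_apply, ← hkb, windowVar_apply, Prod.mk.injEq] at hp
      obtain ⟨rfl, rfl⟩ := hp
      exact absurd b.2 (not_lt.mpr hj)
  calc coeff d (multiSchurPoly lam n)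
      = coeff d (rename (windowVar n) (rename (blockPerm n π) (keyPoly (windowComp lam n)))) := by
        rw [rename_blockPerm_keyPoly (monotone_windowComp lam)]
        rfl
    _ = windowCoeff lam μ n := by
        rw [rename_rename, hd_eq, coeff_rename_mapDomain _ hinj, windowCoeff]

end MultiSchurPolynomials

section MonomialExpansions

variable {r : ℕ}

theorem coeff_sum_multiMonomial {c : (Fin r → Par) →₀ ℚ} {d : Fin r × ℕ →₀ ℕ}
    {μ : Fin r → Par} (h : HasType d μ) :
    MvPowerSeries.coeff d (∑ ν ∈ c.support, c ν • multiMonomial ν) = c μ := by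
  classical
  have hterm : ∀ ν, MvPowerSeries.coeff d (c ν • multiMonomial ν) = if μ = ν then c ν else 0 :=
    fun ν => by
      rw [map_smul, coeff_multiMonomial, smul_eq_mul, mul_ite, mul_one, mul_zero]
      exact if_congr ⟨h.unique, fun hν => hν ▸ h⟩ rfl rfl
  rw [map_sum, Finset.sum_congr rfl fun ν _ => hterm ν, Finset.sum_ite_eq]
  exact ite_eq_left_iff.mpr fun hμ => (Finsupp.notMem_support_iff.mp hμ).symm

theorem IsMonomialExpansion.unique {f : MvPowerSeries (Fin r × ℕ) ℚ}
    {c c' : (Fin r → Par) →₀ ℚ} (h : IsMonomialExpansion f c) (h' : IsMonomialExpansion f c') :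
    c = c' := by
  ext μ
  obtain ⟨d, hd⟩ := exists_hasType_exponent μ
  rw [← coeff_sum_multiMonomial hd, ← h, h', coeff_sum_multiMonomial hd]

theorem IsFormalLimit.unique {σ : Type*} {F : (Fin r → ℕ) → MvPolynomial σ ℚ}
    {f g : MvPowerSeries σ ℚ} (hf : IsFormalLimit F f) (hg : IsFormalLimit F g) : f = g := by
  ext d
  obtain ⟨n, hfn, hgn⟩ := ((hf d).and (hg d)).exists
  rw [← hfn, ← hgn]

/-- The stable coefficients of `𝒮_λ`, as a finitely supported function; they turn out to be the
multi-symmetric Kostka coefficients. -/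
def stableFinsupp (lam : Fin r → Par) : (Fin r → Par) →₀ ℚ :=
  Finsupp.ofSupportFinite (stableCoeff lam) (finite_support_stableCoeff lam)

theorem isFormalLimit_sum_stableFinsupp (lam : Fin r → Par) :
    IsFormalLimit (multiSchurPoly lam)
      (∑ μ ∈ (stableFinsupp lam).support, stableFinsupp lam μ • multiMonomial μ) := by
  intro d
  obtain ⟨N, hN⟩ := exists_eq_zero_of_le d
  obtain ⟨μ, hμ⟩ := exists_type_of_exponent d
  rw [coeff_sum_multiMonomial hμ]
  filter_upwards [eventually_ge_atTop fun _ => N,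
    eventually_ge_atTop fun i => (lam i).parts.degree,
    eventually_ge_atTop fun i => (μ i).parts.degree] with n hn hlam_le hμ_le
  rw [coeff_multiSchurPoly lam hμ fun i j hj => hN i j ((hn i).trans hj)]
  exact windowCoeff_eq_stableCoeff ((fits_degree lam).mono hlam_le) ((fits_degree μ).mono hμ_le)

theorem isFormalLimit_multiSchur (lam : Fin r → Par) :
    IsFormalLimit (multiSchurPoly lam) (multiSchur lam) := by
  have h : ∃ f, IsFormalLimit (multiSchurPoly lam) f := ⟨_, isFormalLimit_sum_stableFinsupp lam⟩
  rw [multiSchur, dif_pos h]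
  exact h.choose_spec

theorem isMonomialExpansion_stableFinsupp (lam : Fin r → Par) :
    IsMonomialExpansion (multiSchur lam) (stableFinsupp lam) :=
  (isFormalLimit_multiSchur lam).unique (isFormalLimit_sum_stableFinsupp lam)

theorem isMonomialExpansion_kostka (lam : Fin r → Par) :
    IsMonomialExpansion (multiSchur lam) (kostka lam) := by
  have h : ∃ c, IsMonomialExpansion (multiSchur lam) c :=
    ⟨_, isMonomialExpansion_stableFinsupp lam⟩
  rw [kostka, dif_pos h]
  exact h.choose_spec

theorem kostka_eq_stableCoeff (lam μ : Fin r → Par) : kostka lam μ = stableCoeff lam μ :=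
  DFunLike.congr_fun
    ((isMonomialExpansion_kostka lam).unique (isMonomialExpansion_stableFinsupp lam)) μ

theorem kostka_self (lam : Fin r → Par) : kostka lam lam = 1 := by
  rw [kostka_eq_stableCoeff, stableCoeff_self]

theorem eq_or_prec_of_mem_support_kostka {lam μ : Fin r → Par} (h : μ ∈ (kostka lam).support) :
    μ = lam ∨ Prec μ lam := by
  rw [Finsupp.mem_support_iff, kostka_eq_stableCoeff] at h
  exact eq_or_prec_of_stableCoeff_ne_zero h

theorem not_prec_self (lam : Fin r → Par) : ¬ Prec lam lam :=
  fun ⟨_, _, _, _, h⟩ => lt_irrefl _ h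

open Classical in
theorem filter_prec_support_kostka (lam : Fin r → Par) :
    ((kostka lam).support.filter fun μ => Prec μ lam) = (kostka lam).support.erase lam := by
  ext μ
  rw [Finset.mem_filter, Finset.mem_erase, and_comm]
  refine and_congr_left fun hμ =>
    ⟨?_, fun hne => (eq_or_prec_of_mem_support_kostka hμ).resolve_left hne⟩
  rintro h rfl
  exact not_prec_self _ h

end MonomialExpansions

end

end MultiSchur

open Classical MultiSchur in
theorem mainTheorem7 (r : ℕ) (lam : Fin r → Par) :
    -- `𝒮_λ` is the (unique) limit of the multi-symmetric Schur polynomials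
    (∀ f, IsFormalLimit (multiSchurPoly lam) f ↔ f = multiSchur lam) ∧
    -- the `K^λ_μ` are the (unique) coefficients of the monomial expansion of `𝒮_λ`
    (∀ c, IsMonomialExpansion (multiSchur lam) c ↔ c = kostka lam) ∧
    -- triangularity
    multiSchur lam = multiMonomial lam +
      ∑ μ ∈ (kostka lam).support with Prec μ lam, kostka lam μ • multiMonomial μ := by
  have hlimit := isFormalLimit_multiSchur lam
  have hexpansion := isMonomialExpansion_kostka lam
  refine ⟨fun f => ⟨fun h => h.unique hlimit, fun h => h ▸ hlimit⟩,
    fun c => ⟨fun h => h.unique hexpansion, fun h => h ▸ hexpansion⟩, ?_⟩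
  have hmem : lam ∈ (kostka lam).support := by simp [kostka_self]
  calc multiSchur lam
      = ∑ μ ∈ (kostka lam).support, kostka lam μ • multiMonomial μ := hexpansion
    _ = kostka lam lam • multiMonomial lam +
        ∑ μ ∈ (kostka lam).support.erase lam, kostka lam μ • multiMonomial μ :=
      (Finset.add_sum_erase _ _ hmem).symm
    _ = multiMonomial lam +
        ∑ μ ∈ (kostka lam).support with Prec μ lam, kostka lam μ • multiMonomial μ := by
      rw [kostka_self, one_smul, filter_prec_support_kostka]
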